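/- Let $q$ and $a$ be indeterminates. Write $(x;q)_k=(1-x)(1-xq)\cdots(1-xq^{k-1})$ for the $q$-shifted factorial and $[m]_q=1+q+\cdots+q^{m-1}$ for the $q$-integer, with $[m]=[m]_q$. For rational functions $A,B$ in $q$ and $a$ and a polynomial $P\in\mathbb{Z}[q,a]$, the congruence $A\equiv B\pmod P$ means that $A-B=u/v$ for some polynomials $u,v\in\mathbb{Z}[q,a]$, $v\neq 0$, such that $P$ divides $u$ and $v$ is relatively prime to $P$ (i.e. has no non-unit common factor with $P$ in $\mathbb{Z}[q,a]$). Let $n>1$ be an odd integer, let $r\geqslant 1$ be an integer, and let $d\in\{1,2\}$. Then, modulo $$ [n^r]\prod_{j=0}^{(n^{r-1}-1)/d}(1-aq^{(2j+1)n})(a-q^{(2j+1)n}), $$ we have $$ \sum_{k=0}^{(n^r-1)/d} q^{k^2}[6k+1]\frac{(aq;q^2)_k (q/a;q^2)_k (q^2;q^4)_k }{(aq^4;q^4)_k(q^4/a;q^4)_k(q^4;q^4)_k} \equiv (-q)^{(1-n)/2} [n] \sum_{k=0}^{(n^{r-1}-1)/d} q^{nk^2}[6k+1]_{q^n}\frac{(aq^n;q^{2n})_k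 (q^n/a;q^{2n})_k (q^{2n};q^{4n})_k }{(aq^{4n};q^{4n})_k(q^{4n}/a;q^{4n})_k(q^{4n};q^{4n})_k}. $$ -/

import Mathlib

open Polynomial Finset

/-- The `q`-shifted factorial `(x; q)_k = (1 - x) (1 - x q) ⋯ (1 - x q^(k-1))`. -/
def qShifted {K : Type*} [CommRing K] (x q : K) (k : ℕ) : K :=
  ∏ i ∈ range k, (1 - x * q ^ i)

/-- The `q`-integer `[m]_q = 1 + q + ⋯ + q^(m-1)`. -/
def qInteger {K : Type*} [CommRing K] (q : K) (m : ℕ) : K :=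
  ∑ i ∈ range m, q ^ i

/-- The polynomial ring `ℤ[q][a]` in the two indeterminates `q` (inner) and `a` (outer). -/
abbrev PolyQA : Type := ℤ[X][X]

/-- The field of rational functions in `q` and `a`. -/
abbrev RatQA : Type := FractionRing PolyQA

/-- The indeterminate `q`, as a polynomial. -/
noncomputable def polyQ : PolyQA := C X

/-- The indeterminate `a`, as a polynomial. -/
noncomputable def polyA : PolyQA := X

/-- The indeterminate `q`, as a rational function. -/
noncomputable def ratQ : RatQA := algebraMap PolyQA RatQA polyQ

/-- The indeterminate `a`, as a rational function. -/
noncomputable def ratA : RatQA := algebraMap PolyQA RatQA polyA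

/-- `A ≡ B (mod P)` for rational functions `A`, `B` and a polynomial `P`: the difference `A - B`
is a fraction `u / v` of polynomials such that `P` divides `u` and `v` has no nonunit common
divisor with `P`. -/
def RatCongr (P : PolyQA) (A B : RatQA) : Prop :=
  ∃ u v : PolyQA, v ≠ 0 ∧ P ∣ u ∧ IsRelPrime v P ∧
    A - B = algebraMap PolyQA RatQA u / algebraMap PolyQA RatQA v

/-- The `a`-deformed sum
`∑_{k=0}^{M} q^(k^2) [6k+1]_q (aq;q^2)_k (q/a;q^2)_k (q^2;q^4)_k
  / ((aq^4;q^4)_k (q^4/a;q^4)_k (q^4;q^4)_k)`. -/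
def deformedSum {K : Type*} [Field K] (a q : K) (M : ℕ) : K :=
  ∑ k ∈ range (M + 1), q ^ (k ^ 2) * qInteger q (6 * k + 1) *
    (qShifted (a * q) (q ^ 2) k * qShifted (q / a) (q ^ 2) k * qShifted (q ^ 2) (q ^ 4) k /
      (qShifted (a * q ^ 4) (q ^ 4) k * qShifted (q ^ 4 / a) (q ^ 4) k *
        qShifted (q ^ 4) (q ^ 4) k))

/-! The engine is the evaluation `(-q)^j S_M(q^(2j+1)) = [2j+1]_q` for `j ≤ M`, where `S_M(a)` is
`deformedSum a q M`. A telescoping certificate gives a contiguous relation between `S_M(b)` and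
`S_M(b q^4)`, whose boundary term vanishes at `b = q^(2j+1)` when `j + 2 ≤ M`, so the evaluation
follows from the cases `j = 0, 1`.

Since `S_M(a) = S_M(1/a)`, this evaluates both sides of the congruence on the two curves
`a = q^(±(2j+1)n)`, where they agree. At a primitive root of unity `z` of odd order `2M+1 > 1`,
multiplying `S_M(a)` by its common denominator gives a polynomial in `a` of degree at most `2M`, and
the same evaluation shows that it vanishes at the `2M+1` powers of `z`, hence identically. Longer
sums split into blocks of length `2M+1` (the last one possibly of length `M+1`), each proportional
to the first by periodicity of the ratio of consecutive terms, so both sides vanish modulo every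
cyclotomic factor of `[n^r]`; when `z^n = 1` it is the factor `[n]` on the right that vanishes. The
prime factors of the modulus are pairwise coprime, and working modulo each of them amounts to
computing in its residue field. -/

section QShifted

variable {R S : Type*} [CommRing R] [CommRing S]

theorem qShifted_succ (x q : R) (k : ℕ) :
    qShifted x q (k + 1) = qShifted x q k * (1 - x * q ^ k) :=
  prod_range_succ _ _

theorem qShifted_ne_zero [IsDomain R] {x q : R} {k : ℕ} (h : ∀ i < k, x * q ^ i ≠ 1) :
    qShifted x q k ≠ 0 :=
  prod_ne_zero_iff.mpr fun i hi => sub_ne_zero.mpr (h i (mem_range.mp hi)).symm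

theorem map_qShifted (f : R →+* S) (x q : R) (k : ℕ) :
    f (qShifted x q k) = qShifted (f x) (f q) k := by
  simp [qShifted]

theorem map_qInteger (f : R →+* S) (q : R) (m : ℕ) : f (qInteger q m) = qInteger (f q) m := by
  simp [qInteger]

theorem qInteger_mul_one_sub (q : R) (m : ℕ) : qInteger q m * (1 - q) = 1 - q ^ m :=
  geom_sum_mul_neg q m

end QShifted

section Weight

variable {R S : Type*} [CommRing R] [CommRing S]

/-- Numerator of the ratio of the `(i + 1)`-st to the `i`-th `q`-shifted factorial quotient in
`deformedSum a q`, cleared of the denominator `a`. -/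
def ratioNum (a q : R) (i : ℕ) : R :=
  (1 - a * q ^ (2 * i + 1)) * (a - q ^ (2 * i + 1)) * (1 - q ^ (4 * i + 2))

/-- Denominator of the ratio of the `(i + 1)`-st to the `i`-th `q`-shifted factorial quotient in
`deformedSum a q`, cleared of the denominator `a`. -/
def ratioDen (a q : R) (i : ℕ) : R :=
  (1 - a * q ^ (4 * i + 4)) * (a - q ^ (4 * i + 4)) * (1 - q ^ (4 * i + 4))

/-- The factor `q^(k^2) [6k+1]_q` of the `k`-th summand of `deformedSum`. -/
def deformedCoeff (q : R) (k : ℕ) : R :=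
  q ^ (k ^ 2) * qInteger q (6 * k + 1)

theorem map_ratioNum (f : R →+* S) (a q : R) (i : ℕ) :
    f (ratioNum a q i) = ratioNum (f a) (f q) i := by
  simp [ratioNum]

theorem map_ratioDen (f : R →+* S) (a q : R) (i : ℕ) :
    f (ratioDen a q i) = ratioDen (f a) (f q) i := by
  simp [ratioDen]

theorem map_deformedCoeff (f : R →+* S) (q : R) (k : ℕ) :
    f (deformedCoeff q k) = deformedCoeff (f q) k := by
  simp [deformedCoeff, map_qInteger]

theorem ratioNum_pow_odd (q : R) (j : ℕ) : ratioNum (q ^ (2 * j + 1)) q j = 0 := by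
  simp [ratioNum]

theorem ratioDen_ne_zero [IsDomain R] {a q : R} {i : ℕ} (h₁ : a * q ^ (4 * i + 4) ≠ 1)
    (h₂ : a ≠ q ^ (4 * i + 4)) (h₃ : q ^ (4 * i + 4) ≠ 1) : ratioDen a q i ≠ 0 :=
  mul_ne_zero (mul_ne_zero (sub_ne_zero.mpr h₁.symm) (sub_ne_zero.mpr h₂)) (sub_ne_zero.mpr h₃.symm)

variable {K : Type*} [Field K]

/-- The `q`-shifted factorial quotient in the `k`-th summand of `deformedSum a q`, for `a ≠ 0`. -/
def deformedWeight (a q : K) (k : ℕ) : K :=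
  ∏ i ∈ range k, ratioNum a q i / ratioDen a q i

theorem deformedWeight_succ (a q : K) (k : ℕ) :
    deformedWeight a q (k + 1) = deformedWeight a q k * (ratioNum a q k / ratioDen a q k) :=
  prod_range_succ _ _

theorem deformedWeight_eq_zero {a q : K} {i k : ℕ} (hik : i < k) (h : ratioNum a q i = 0) :
    deformedWeight a q k = 0 :=
  prod_eq_zero (mem_range.mpr hik) (by rw [h, zero_div])

theorem deformedSum_eq_sum_weight {a : K} (ha : a ≠ 0) (q : K) (M : ℕ) :
    deformedSum a q M = ∑ k ∈ range (M + 1), deformedCoeff q k * deformedWeight a q k := by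
  refine sum_congr rfl fun k _ => congrArg _ ?_
  simp only [qShifted, deformedWeight, ← prod_mul_distrib, ← prod_div_distrib]
  refine prod_congr rfl fun i _ => ?_
  have hnum : (1 - a * q * (q ^ 2) ^ i) * (1 - q / a * (q ^ 2) ^ i) * (1 - q ^ 2 * (q ^ 4) ^ i) =
      ratioNum a q i / a := by
    rw [ratioNum]
    field_simp
    ring
  have hden : (1 - a * q ^ 4 * (q ^ 4) ^ i) * (1 - q ^ 4 / a * (q ^ 4) ^ i) *
      (1 - q ^ 4 * (q ^ 4) ^ i) = ratioDen a q i / a := by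
    rw [ratioDen]
    field_simp
    ring
  rw [hnum, hden, div_div_div_cancel_right₀ ha]

theorem deformedSum_inv (a q : K) (M : ℕ) : deformedSum a⁻¹ q M = deformedSum a q M := by
  simp only [deformedSum, div_inv_eq_mul, inv_mul_eq_div, mul_comm q a, mul_comm (q ^ 4) a,
    mul_comm (qShifted (q / a) _ _), mul_comm (qShifted (q ^ 4 / a) _ _)]

end Weight

section ClosedForm

variable {K : Type*} [Field K]

theorem deformedWeight_mul_pow_four {b q : K} (hden : ∀ i, ratioDen b q i ≠ 0)
    (hden' : ∀ i, ratioDen (b * q ^ 4) q i ≠ 0) (k : ℕ) :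
    deformedWeight b q k * ((1 - b * q * q ^ (2 * k)) * (1 - b * q ^ 3 * q ^ (2 * k)) *
        (1 - b * q ^ 4) * (b - (q ^ (2 * k)) ^ 2)) =
      deformedWeight (b * q ^ 4) q k * ((b * q ^ 3 - q ^ (2 * k)) * (b * q - q ^ (2 * k)) *
        (1 - b * q ^ 4 * (q ^ (2 * k)) ^ 2) * (b - 1)) := by
  induction k with
  | zero =>
    simp only [deformedWeight, range_zero, prod_empty, mul_zero, pow_zero]
    ring
  | succ k ih =>
    have hk := hden k
    have hk' := hden' k
    simp only [ratioDen, mul_ne_zero_iff] at hk hk'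
    have hx : q ^ (2 * (k + 1)) = q ^ (2 * k) * q ^ 2 := by ring
    have hx₁ : q ^ (2 * k + 1) = q ^ (2 * k) * q := by ring
    have hx₂ : q ^ (4 * k + 2) = (q ^ (2 * k)) ^ 2 * q ^ 2 := by ring
    have hx₄ : q ^ (4 * k + 4) = (q ^ (2 * k)) ^ 2 * q ^ 4 := by ring
    rw [deformedWeight_succ, deformedWeight_succ, ratioNum, ratioNum, ratioDen, ratioDen]
    rw [hx₄] at hk hk'
    rw [hx, hx₁, hx₂, hx₄]
    generalize q ^ (2 * k) = x at *
    have hρ : (1 - b * (x ^ 2 * q ^ 4)) * (b * q ^ 4 - x ^ 2 * q ^ 4) * (1 - x ^ 2 * q ^ 4) ≠ 0 :=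
      mul_ne_zero (mul_ne_zero hk.1.1 hk'.1.2) hk.2
    set ρ := (1 - b * q ^ 5 * x) * (b * q ^ 4 - q ^ 5 * x) * (1 - x ^ 2 * q ^ 2) /
      ((1 - b * (x ^ 2 * q ^ 4)) * (b * q ^ 4 - x ^ 2 * q ^ 4) * (1 - x ^ 2 * q ^ 4)) with hρ_def
    calc
      _ = deformedWeight b q k * ((1 - b * q * x) * (1 - b * q ^ 3 * x) * (1 - b * q ^ 4) *
          (b - x ^ 2)) * ρ := by
        rw [mul_assoc (deformedWeight b q k), mul_assoc (deformedWeight b q k)]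
        congr 1
        rw [hρ_def, div_mul_eq_mul_div, mul_div_assoc', div_eq_div_iff
          (mul_ne_zero (mul_ne_zero hk.1.1 hk.1.2) hk.2) hρ]
        ring
      _ = _ := by
        rw [ih, mul_assoc (deformedWeight (b * q ^ 4) q k),
          mul_assoc (deformedWeight (b * q ^ 4) q k)]
        congr 1
        rw [hρ_def, div_mul_eq_mul_div, mul_div_assoc', div_eq_div_iff hρ
          (mul_ne_zero (mul_ne_zero hk'.1.1 hk'.1.2) hk'.2)]
        ring

/-- Antidifference of the contiguous relation between the deformed sums at `b` and `b q^4`. -/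
def contiguousCert (b q : K) (k : ℕ) : K :=
  q ^ (k ^ 2) * deformedWeight (b * q ^ 4) q k *
    (q * (1 - (q ^ (2 * k)) ^ 2) * (1 - b * q ^ 4 * (q ^ (2 * k)) ^ 2) * (1 - b) *
      (1 + b * q ^ 2) * (q - q ^ (2 * k)) /
      ((1 - b * q * q ^ (2 * k)) * (1 - b * q ^ 3 * q ^ (2 * k))))

theorem contiguousCert_succ {b q : K} (hq : q ≠ 0) (hb : ∀ i, b * q ^ (2 * i + 1) ≠ 1) (k : ℕ)
    (hden : ratioDen (b * q ^ 4) q k ≠ 0) :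
    contiguousCert b q (k + 1) = q ^ (k ^ 2) * deformedWeight (b * q ^ 4) q k *
      (q ^ (2 * k) * (b * q ^ 3 - q ^ (2 * k)) * (1 - q ^ 2 * (q ^ (2 * k)) ^ 2) * (1 - b) *
        (1 + b * q ^ 2) * (1 - q * q ^ (2 * k)) /
        ((b - (q ^ (2 * k)) ^ 2) * (1 - b * q ^ 3 * q ^ (2 * k)))) := by
  have h₃ : 1 - b * q ^ 3 * q ^ (2 * k) ≠ 0 := fun h => hb (k + 1) (by linear_combination -h)
  have h₅ : 1 - b * q ^ 5 * q ^ (2 * k) ≠ 0 := fun h => hb (k + 2) (by linear_combination -h)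
  have hx : q ^ (2 * (k + 1)) = q ^ (2 * k) * q ^ 2 := by ring
  have hx₁ : q ^ (2 * k + 1) = q ^ (2 * k) * q := by ring
  have hx₂ : q ^ (4 * k + 2) = (q ^ (2 * k)) ^ 2 * q ^ 2 := by ring
  have hx₄ : q ^ (4 * k + 4) = (q ^ (2 * k)) ^ 2 * q ^ 4 := by ring
  have hsq : q ^ ((k + 1) ^ 2) = q ^ (k ^ 2) * (q * q ^ (2 * k)) := by ring
  rw [contiguousCert, deformedWeight_succ, ratioNum, ratioDen, hx, hx₁, hx₂, hx₄, hsq]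
  rw [ratioDen, hx₄] at hden
  generalize q ^ (2 * k) = x at *
  simp only [mul_ne_zero_iff] at hden
  obtain ⟨⟨h₈, h₄⟩, h₄'⟩ := hden
  have hbx : b - x ^ 2 ≠ 0 := fun h => h₄ (by linear_combination q ^ 4 * h)
  calc
    _ = q ^ (k ^ 2) * deformedWeight (b * q ^ 4) q k * (q * x * ((1 - b * q ^ 4 * (x * q)) *
        (b * q ^ 4 - x * q) * (1 - x ^ 2 * q ^ 2) / ((1 - b * q ^ 4 * (x ^ 2 * q ^ 4)) *
          (q ^ 4 * (b - x ^ 2)) * (1 - x ^ 2 * q ^ 4))) * (q * (1 - x ^ 2 * q ^ 4) *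
          (1 - b * q ^ 4 * (x ^ 2 * q ^ 4)) * (1 - b) * (1 + b * q ^ 2) * (q - x * q ^ 2) /
          ((1 - b * q ^ 3 * x) * (1 - b * q ^ 5 * x)))) := by ring
    _ = _ := by
      congr 1
      rw [mul_div_assoc', mul_div_assoc', div_mul_eq_mul_div, div_div,
        div_eq_div_iff (by simp [*]) (by simp [*])]
      ring

theorem contiguousCert_succ_sub {b q : K} (hq : q ≠ 0) (hb : ∀ i, b * q ^ (2 * i + 1) ≠ 1)
    (hden : ∀ i, ratioDen b q i ≠ 0) (hden' : ∀ i, ratioDen (b * q ^ 4) q i ≠ 0) (k : ℕ) :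
    contiguousCert b q (k + 1) - contiguousCert b q k =
      q ^ (k ^ 2) * (1 - q ^ (6 * k + 1)) * ((1 - b * q ^ 4) * deformedWeight b q k -
        q ^ 2 * (1 - b) * deformedWeight (b * q ^ 4) q k) := by
  have hshift := deformedWeight_mul_pow_four hden hden' k
  have h₁ : 1 - b * q * q ^ (2 * k) ≠ 0 := fun h => hb k (by linear_combination -h)
  have h₃ : 1 - b * q ^ 3 * q ^ (2 * k) ≠ 0 := fun h => hb (k + 1) (by linear_combination -h)
  have h₄ : b - (q ^ (2 * k)) ^ 2 ≠ 0 := fun h => hden' k (by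
    rw [ratioDen]
    linear_combination (1 - b * q ^ 4 * q ^ (4 * k + 4)) * q ^ 4 * (1 - q ^ (4 * k + 4)) * h)
  have hx₆ : q ^ (6 * k + 1) = q * (q ^ (2 * k)) ^ 3 := by ring
  rw [contiguousCert_succ hq hb k (hden' k), contiguousCert, hx₆]
  clear hb hden hden' hx₆
  generalize q ^ (2 * k) = x at *
  have hweight : (1 - b * q ^ 4) * deformedWeight b q k = deformedWeight (b * q ^ 4) q k *
      ((b * q ^ 3 - x) * (b * q - x) * (1 - b * q ^ 4 * x ^ 2) * (b - 1) /
        ((1 - b * q * x) * (1 - b * q ^ 3 * x) * (b - x ^ 2))) := by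
    field_simp
    linear_combination hshift
  rw [hweight]
  field_simp
  ring

theorem deformedSum_mul_pow_four {b q : K} (hq : q ≠ 0) (hb₀ : b ≠ 0)
    (hb : ∀ i, b * q ^ (2 * i + 1) ≠ 1) (hden : ∀ i, ratioDen b q i ≠ 0)
    (hden' : ∀ i, ratioDen (b * q ^ 4) q i ≠ 0) (M : ℕ) :
    (1 - q) * ((1 - b * q ^ 4) * deformedSum b q M -
      q ^ 2 * (1 - b) * deformedSum (b * q ^ 4) q M) = contiguousCert b q (M + 1) := by
  rw [deformedSum_eq_sum_weight hb₀, deformedSum_eq_sum_weight (mul_ne_zero hb₀ (pow_ne_zero 4 hq)),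
    mul_sum, mul_sum, ← sum_sub_distrib, mul_sum]
  calc
    _ = ∑ k ∈ range (M + 1), (contiguousCert b q (k + 1) - contiguousCert b q k) := by
      refine sum_congr rfl fun k _ => ?_
      rw [contiguousCert_succ_sub hq hb hden hden', ← qInteger_mul_one_sub, deformedCoeff]
      ring
    _ = _ := by
      rw [sum_range_sub]
      simp [contiguousCert]

variable {q : K} (hq : Function.Injective (q ^ · : ℕ → K))

include hq

theorem pow_ne_one_of_injective {m : ℕ} (hm : m ≠ 0) : q ^ m ≠ 1 := fun h =>
  hm (hq (by simpa using h))

theorem ne_zero_of_injective : q ≠ 0 := fun h =>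
  OfNat.one_ne_ofNat 2 (hq (by simp [h]))

theorem ratioDen_pow_odd_ne_zero (j i : ℕ) : ratioDen (q ^ (2 * j + 1)) q i ≠ 0 := by
  refine ratioDen_ne_zero ?_ (fun h => ?_) (pow_ne_one_of_injective hq (by omega))
  · rw [← pow_add]
    exact pow_ne_one_of_injective hq (by omega)
  · have := hq h
    omega

theorem deformedSum_self (M : ℕ) : deformedSum q q M = 1 := by
  have hnum : ratioNum q q 0 = 0 := by simpa using ratioNum_pow_odd q 0
  rw [deformedSum_eq_sum_weight (ne_zero_of_injective hq), sum_range_succ',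
    sum_eq_zero fun k _ => ?_]
  · simp [deformedCoeff, deformedWeight, qInteger]
  · rw [deformedWeight_eq_zero k.succ_pos hnum, mul_zero]

theorem neg_mul_deformedSum_pow_three (M : ℕ) :
    -q * deformedSum (q ^ 3) q (M + 1) = qInteger q 3 := by
  rw [deformedSum_eq_sum_weight (pow_ne_zero _ (ne_zero_of_injective hq)), sum_range_succ',
    sum_range_succ', sum_eq_zero fun k _ => ?_]
  · have hden := ratioDen_pow_odd_ne_zero hq 1 0
    simp only [deformedCoeff, deformedWeight, qInteger, prod_range_succ, sum_range_succ,
      prod_range_zero, sum_range_zero]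
    field_simp
    simp only [ratioNum, ratioDen]
    ring
  · rw [deformedWeight_eq_zero (by omega) (ratioNum_pow_odd q 1), mul_zero]

theorem neg_pow_mul_deformedSum_pow_odd (M : ℕ) :
    ∀ j ≤ M, (-q) ^ j * deformedSum (q ^ (2 * j + 1)) q M = qInteger q (2 * j + 1) := by
  have hq₀ : q ≠ 0 := ne_zero_of_injective hq
  have hq₁ : 1 - q ≠ 0 :=
    sub_ne_zero.mpr (by simpa using (pow_ne_one_of_injective hq one_ne_zero).symm)
  intro j
  induction j using Nat.twoStepInduction with
  | zero =>
    intro _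
    simp [deformedSum_self hq, qInteger]
  | one =>
    intro hM
    obtain ⟨M, rfl⟩ := Nat.exists_eq_add_of_le' hM
    simpa using neg_mul_deformedSum_pow_three hq M
  | more j ih _ =>
    intro hj
    have hpow : q ^ (2 * (j + 2) + 1) = q ^ (2 * j + 1) * q ^ 4 := by ring
    have hcert : contiguousCert (q ^ (2 * j + 1)) q (M + 1) = 0 := by
      rw [contiguousCert, ← hpow, deformedWeight_eq_zero (by omega) (ratioNum_pow_odd q (j + 2)),
        mul_zero, zero_mul]
    have hrel := deformedSum_mul_pow_four hq₀ (pow_ne_zero (2 * j + 1) hq₀)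
      (fun i => by rw [← pow_add]; exact pow_ne_one_of_injective hq (by omega))
      (ratioDen_pow_odd_ne_zero hq j) (hpow ▸ ratioDen_pow_odd_ne_zero hq (j + 2)) M
    rw [hcert, ← hpow] at hrel
    have hb : 1 - q ^ (2 * j + 1) ≠ 0 :=
      sub_ne_zero.mpr (pow_ne_one_of_injective hq (by omega)).symm
    apply mul_left_cancel₀ (mul_ne_zero hq₁ hb)
    have hnum := qInteger_mul_one_sub q (2 * j + 1)
    have hnum' := qInteger_mul_one_sub q (2 * (j + 2) + 1)
    have hj' := ih (by omega)
    linear_combination -(-q) ^ j * hrel + (1 - q) * (1 - q ^ (2 * (j + 2) + 1)) * hj' +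
      (1 - q ^ (2 * (j + 2) + 1)) * hnum - (1 - q ^ (2 * j + 1)) * hnum'

end ClosedForm

section ClearedSum

variable {R S : Type*} [CommRing R] [CommRing S]

/-- The sum `deformedSum a q M` multiplied by the common denominator `∏ i < M, ratioDen a q i`; it
makes sense in any commutative ring and is a polynomial in `a` of degree at most `2 M`. -/
def clearedSum (a q : R) (M : ℕ) : R :=
  ∑ k ∈ range (M + 1), deformedCoeff q k *
    ((∏ i ∈ range k, ratioNum a q i) * ∏ i ∈ Ico k M, ratioDen a q i)

theorem map_clearedSum (f : R →+* S) (a q : R) (M : ℕ) :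
    f (clearedSum a q M) = clearedSum (f a) (f q) M := by
  simp [clearedSum, map_ratioNum, map_ratioDen, map_deformedCoeff]

theorem natDegree_clearedSum_X_le (z : R) (M : ℕ) : (clearedSum X (C z) M).natDegree ≤ 2 * M := by
  have hlin (c : R) : (1 - X * C c).natDegree ≤ 1 := by compute_degree
  have hlin' (c : R) : (X - C c).natDegree ≤ 1 := by compute_degree
  have hconst (c : R) : (1 - C c).natDegree ≤ 0 := by compute_degree
  have hnum (i : ℕ) : (ratioNum X (C z) i).natDegree ≤ 2 := by
    simp only [ratioNum, ← C_pow]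
    exact natDegree_mul_le_of_le (natDegree_mul_le_of_le (hlin _) (hlin' _)) (hconst _)
  have hden (i : ℕ) : (ratioDen X (C z) i).natDegree ≤ 2 := by
    simp only [ratioDen, ← C_pow]
    exact natDegree_mul_le_of_le (natDegree_mul_le_of_le (hlin _) (hlin' _)) (hconst _)
  refine natDegree_sum_le_of_forall_le _ _ fun k hk => ?_
  have hcoeff : (deformedCoeff (C z) k).natDegree ≤ 0 := by
    rw [← map_deformedCoeff, natDegree_C]
  have hnums := (natDegree_prod_le (range k) (ratioNum X (C z))).trans
    (sum_le_card_nsmul _ _ 2 fun i _ => hnum i)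
  have hdens := (natDegree_prod_le (Ico k M) (ratioDen X (C z))).trans
    (sum_le_card_nsmul _ _ 2 fun i _ => hden i)
  refine (natDegree_mul_le_of_le hcoeff (natDegree_mul_le_of_le hnums hdens)).trans ?_
  simp only [card_range, Nat.card_Ico, smul_eq_mul, mem_range] at hk ⊢
  omega

variable {K : Type*} [Field K]

theorem clearedSum_eq_deformedSum_mul {a : K} (ha : a ≠ 0) (q : K) {M : ℕ}
    (hden : ∀ i < M, ratioDen a q i ≠ 0) :
    clearedSum a q M = deformedSum a q M * ∏ i ∈ range M, ratioDen a q i := by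
  rw [clearedSum, deformedSum_eq_sum_weight ha, sum_mul]
  refine sum_congr rfl fun k hk => ?_
  have hkM : k ≤ M := mem_range_succ_iff.mp hk
  have hprod : ∏ i ∈ range k, ratioDen a q i ≠ 0 :=
    prod_ne_zero_iff.mpr fun i hi => hden i ((mem_range.mp hi).trans_le hkM)
  rw [deformedWeight, prod_div_distrib, ← prod_range_mul_prod_Ico _ hkM]
  field_simp

theorem clearedSum_inv {a : K} (ha : a ≠ 0) (q : K) (M : ℕ) :
    clearedSum a⁻¹ q M * (a ^ 2) ^ M = clearedSum a q M := by
  have hnum (i : ℕ) : ratioNum a q i = ratioNum a⁻¹ q i * a ^ 2 := by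
    rw [ratioNum, ratioNum]
    field_simp
  have hden (i : ℕ) : ratioDen a q i = ratioDen a⁻¹ q i * a ^ 2 := by
    rw [ratioDen, ratioDen]
    field_simp
  rw [clearedSum, clearedSum, sum_mul]
  refine sum_congr rfl fun k hk => ?_
  have hkM : k ≤ M := mem_range_succ_iff.mp hk
  simp only [hnum, hden, prod_mul_distrib, prod_const, card_range, Nat.card_Ico]
  rw [← pow_mul_pow_sub (a ^ 2) hkM]
  ring

theorem injective_pow_algebraMap_X :
    Function.Injective (algebraMap ℤ[X] (FractionRing ℤ[X]) X ^ · : ℕ → FractionRing ℤ[X]) := by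
  intro k l h
  simp only [← map_pow] at h
  simpa using congrArg natDegree (IsFractionRing.injective ℤ[X] (FractionRing ℤ[X]) h)

theorem neg_pow_mul_clearedSum_pow_odd (z : R) {M j : ℕ} (hj : j ≤ M) :
    (-z) ^ j * clearedSum (z ^ (2 * j + 1)) z M =
      qInteger z (2 * j + 1) * ∏ i ∈ range M, ratioDen (z ^ (2 * j + 1)) z i := by
  have hX : (-X) ^ j * clearedSum (X ^ (2 * j + 1)) X M =
      qInteger (X : ℤ[X]) (2 * j + 1) * ∏ i ∈ range M, ratioDen (X ^ (2 * j + 1)) X i := by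
    apply IsFractionRing.injective ℤ[X] (FractionRing ℤ[X])
    have hq := injective_pow_algebraMap_X
    simp only [map_mul, map_clearedSum, map_prod, map_qInteger, map_ratioDen, map_pow, map_neg]
    rw [clearedSum_eq_deformedSum_mul (pow_ne_zero _ (ne_zero_of_injective hq)) _
      fun i _ => ratioDen_pow_odd_ne_zero hq j i, ← mul_assoc,
      neg_pow_mul_deformedSum_pow_odd hq M j hj]
  have hz := congrArg (eval₂RingHom (Int.castRingHom R) z) hX
  simp only [map_mul, map_clearedSum, map_prod, map_qInteger, map_ratioDen, map_pow, map_neg,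
    coe_eval₂RingHom, eval₂_X] at hz
  exact hz

end ClearedSum

section RootOfUnity

variable {K : Type*} [Field K] {z : K} {M : ℕ} (hM : M ≠ 0) (hz : IsPrimitiveRoot z (2 * M + 1))

include hM hz

theorem clearedSum_pow_odd_eq_zero {j : ℕ} (hj : j ≤ M) :
    clearedSum (z ^ (2 * j + 1)) z M = 0 := by
  have hz₀ : (-z) ^ j ≠ 0 := pow_ne_zero _ (neg_ne_zero.mpr (hz.ne_zero (by omega)))
  refine (mul_eq_zero.mp ((neg_pow_mul_clearedSum_pow_odd z hj).trans ?_)).resolve_left hz₀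
  rcases hj.eq_or_lt with rfl | hlt
  · rw [qInteger, hz.geom_sum_eq_zero (by omega), zero_mul]
  refine mul_eq_zero_of_right _ ?_
  rcases Nat.even_or_odd (M - j) with ⟨t, ht⟩ | ⟨t, ht⟩
  · refine prod_eq_zero (mem_range.mpr (show t - 1 < M by omega)) ?_
    rw [ratioDen, ← pow_add, show 2 * j + 1 + (4 * (t - 1) + 4) = 2 * M + 1 by omega,
      hz.pow_eq_one, sub_self, zero_mul, zero_mul]
  · refine prod_eq_zero (mem_range.mpr (show (M + j - 1) / 2 < M by omega)) ?_
    rw [ratioDen, show 4 * ((M + j - 1) / 2) + 4 = (2 * j + 1) + (2 * M + 1) by omega,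
      pow_add z (2 * j + 1) (2 * M + 1), hz.pow_eq_one, mul_one, sub_self, mul_zero, zero_mul]

theorem clearedSum_pow_eq_zero {e : ℕ} (he : e < 2 * M + 1) : clearedSum (z ^ e) z M = 0 := by
  rcases Nat.even_or_odd e with ⟨t, rfl⟩ | ⟨t, rfl⟩
  · have hz₀ : z ^ (2 * (M - t) + 1) ≠ 0 := pow_ne_zero _ (hz.ne_zero (by omega))
    have hinv : (z ^ (2 * (M - t) + 1))⁻¹ = z ^ (t + t) := by
      rw [inv_eq_iff_eq_inv, ← mul_eq_one_iff_eq_inv₀ (pow_ne_zero _ (hz.ne_zero (by omega))),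
        ← pow_add, show 2 * (M - t) + 1 + (t + t) = 2 * M + 1 by omega, hz.pow_eq_one]
    have hsymm := clearedSum_inv hz₀ z M
    rw [clearedSum_pow_odd_eq_zero hM hz (by omega), hinv] at hsymm
    exact (mul_eq_zero.mp hsymm).resolve_right (pow_ne_zero _ (pow_ne_zero _ hz₀))
  · exact clearedSum_pow_odd_eq_zero hM hz (by omega)

theorem clearedSum_eq_zero (x : K) : clearedSum x z M = 0 := by
  have heval (y : K) : (clearedSum X (C z) M).eval y = clearedSum y z M := by
    simpa using map_clearedSum (evalRingHom y) X (C z) M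
  have hpoly : clearedSum X (C z) M = 0 :=
    eq_zero_of_natDegree_lt_card_of_eval_eq_zero _ (f := fun e : Fin (2 * M + 1) => z ^ (e : ℕ))
      (fun e e' h => Fin.ext (hz.pow_inj e.2 e'.2 h))
      (fun e => (heval _).trans (clearedSum_pow_eq_zero hM hz e.2))
      (by simpa using Nat.lt_succ_of_le (natDegree_clearedSum_X_le z M))
  rw [← heval, hpoly, eval_zero]

end RootOfUnity

/-- `x` is nonzero and not an integral power of `q`, so that no denominator of `deformedSum x q`
depending on `x` vanishes. -/
structure IsGeneric {R : Type*} [CommRing R] (x q : R) : Prop where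
  ne_zero : x ≠ 0
  ne_pow : ∀ i : ℕ, x ≠ q ^ i
  mul_pow_ne_one : ∀ i : ℕ, x * q ^ i ≠ 1

theorem IsGeneric.pow {R : Type*} [CommRing R] {x z : R} (hx : IsGeneric x z) (m : ℕ) :
    IsGeneric x (z ^ m) where
  ne_zero := hx.ne_zero
  ne_pow i := by rw [← pow_mul]; exact hx.ne_pow _
  mul_pow_ne_one i := by rw [← pow_mul]; exact hx.mul_pow_ne_one _

section Blocks

theorem not_dvd_four_mul {M k : ℕ} (hk : k < 2 * M) : ¬ 2 * M + 1 ∣ 4 * k + 4 := fun hdvd => by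
  have hcop : Nat.Coprime (2 * M + 1) 4 := Nat.Coprime.pow_right 2 (by simp : Nat.Coprime _ 2)
  have := Nat.le_of_dvd k.succ_pos (hcop.dvd_of_dvd_mul_left hdvd)
  omega

section Periodicity

variable {R : Type*} [CommRing R] {z : R} {m : ℕ}

theorem ratioNum_periodic (x : R) (hz : z ^ m = 1) : Function.Periodic (ratioNum x z) m :=
  fun i => by simp only [ratioNum, mul_add, add_right_comm _ (_ * m), pow_add, pow_mul', hz,
    one_pow, mul_one]

theorem ratioDen_periodic (x : R) (hz : z ^ m = 1) : Function.Periodic (ratioDen x z) m :=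
  fun i => by simp only [ratioDen, mul_add, add_right_comm _ (_ * m), pow_add, pow_mul', hz,
    one_pow, mul_one]

variable [IsDomain R]

theorem deformedCoeff_periodic (hz₁ : z ≠ 1) (hz : z ^ m = 1) :
    Function.Periodic (deformedCoeff z) m := fun k => by
  apply mul_right_cancel₀ (sub_ne_zero.mpr hz₁.symm)
  have hsq : z ^ ((k + m) ^ 2) = z ^ (k ^ 2) := by
    rw [show (k + m) ^ 2 = k ^ 2 + m * (2 * k + m) by ring, pow_add, pow_mul, hz, one_pow, mul_one]
  have hlin : z ^ (6 * (k + m) + 1) = z ^ (6 * k + 1) := by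
    rw [show 6 * (k + m) + 1 = 6 * k + 1 + m * 6 by ring, pow_add, pow_mul, hz, one_pow, mul_one]
  rw [deformedCoeff, deformedCoeff, mul_assoc, mul_assoc, qInteger_mul_one_sub,
    qInteger_mul_one_sub, hsq, hlin]

theorem IsGeneric.ratioDen_ne_zero {x : R} (hx : IsGeneric x z) (hz : IsPrimitiveRoot z m) {i : ℕ}
    (hi : ¬ m ∣ 4 * i + 4) : ratioDen x z i ≠ 0 :=
  _root_.ratioDen_ne_zero (hx.mul_pow_ne_one _) (hx.ne_pow _)
    fun h => hi ((hz.pow_eq_one_iff_dvd _).mp h)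

end Periodicity

variable {K : Type*} [Field K] {x z : K}

variable {M : ℕ} (hz : IsPrimitiveRoot z (2 * M + 1)) (hx : IsGeneric x z)

include hz hx

theorem weight_add_mul_period {W : ℕ → K}
    (hW : ∀ k, W (k + 1) * ratioDen x z k = W k * ratioNum x z k) (s : ℕ) {t : ℕ}
    (ht : t ≤ 2 * M) :
    W (t + s * (2 * M + 1)) = W (s * (2 * M + 1)) * deformedWeight x z t := by
  induction t with
  | zero => simp [deformedWeight]
  | succ t ih =>
    have hden := hx.ratioDen_ne_zero hz (not_dvd_four_mul (M := M) (k := t) (by omega))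
    have hratioNum : ratioNum x z (t + s * (2 * M + 1)) = ratioNum x z t :=
      (ratioNum_periodic x hz.pow_eq_one).nsmul s t
    have hratioDen : ratioDen x z (t + s * (2 * M + 1)) = ratioDen x z t :=
      (ratioDen_periodic x hz.pow_eq_one).nsmul s t
    have h := hW (t + s * (2 * M + 1))
    rw [ih (by omega), hratioNum, hratioDen] at h
    rw [deformedWeight_succ, add_right_comm, ← mul_assoc, mul_div_assoc', eq_div_iff hden, h]

variable (hM : M ≠ 0)

include hM

theorem deformedSum_eq_zero_of_isPrimitiveRoot {L : ℕ} (hL : M ≤ L) : deformedSum x z L = 0 := by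
  have hden : ∀ i < M, ratioDen x z i ≠ 0 := fun i hi =>
    hx.ratioDen_ne_zero hz (not_dvd_four_mul (by omega))
  have hnum : ratioNum x z M = 0 := by
    rw [ratioNum, show 4 * M + 2 = (2 * M + 1) * 2 by ring, pow_mul, hz.pow_eq_one, one_pow,
      sub_self, mul_zero]
  have hzero : deformedSum x z M = 0 := by
    have h := clearedSum_eq_deformedSum_mul hx.ne_zero z hden
    rw [clearedSum_eq_zero hM hz] at h
    exact (mul_eq_zero.mp h.symm).resolve_right
      (prod_ne_zero_iff.mpr fun i hi => hden i (mem_range.mp hi))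
  obtain ⟨c, rfl⟩ := Nat.exists_eq_add_of_le hL
  rw [deformedSum_eq_sum_weight hx.ne_zero] at hzero ⊢
  rw [add_right_comm, sum_range_add, hzero, zero_add]
  exact sum_eq_zero fun k _ => by rw [deformedWeight_eq_zero (by omega) hnum, mul_zero]

theorem sum_block_eq_zero {W : ℕ → K}
    (hW : ∀ k, W (k + 1) * ratioDen x z k = W k * ratioNum x z k) (s : ℕ) {L : ℕ} (hML : M < L)
    (hL : L ≤ 2 * M + 1) :
    ∑ t ∈ range L, deformedCoeff z (t + s * (2 * M + 1)) * W (t + s * (2 * M + 1)) = 0 := by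
  have hz₁ : z ≠ 1 := hz.ne_one (by omega)
  calc
    _ = ∑ t ∈ range L, W (s * (2 * M + 1)) * (deformedCoeff z t * deformedWeight x z t) := by
      refine sum_congr rfl fun t ht => ?_
      have htL := mem_range.mp ht
      have hcoeff : deformedCoeff z (t + s * (2 * M + 1)) = deformedCoeff z t :=
        (deformedCoeff_periodic hz₁ hz.pow_eq_one).nsmul s t
      rw [weight_add_mul_period hz hx hW s (by omega), hcoeff, mul_left_comm]
    _ = W (s * (2 * M + 1)) * deformedSum x z (L - 1) := by
      rw [← mul_sum, deformedSum_eq_sum_weight hx.ne_zero, Nat.sub_add_cancel (by omega)]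
    _ = 0 := by rw [deformedSum_eq_zero_of_isPrimitiveRoot hz hx hM (by omega), mul_zero]

theorem sum_blocks_eq_zero {W : ℕ → K}
    (hW : ∀ k, W (k + 1) * ratioDen x z k = W k * ratioNum x z k) (s : ℕ) {L : ℕ} (hML : M < L)
    (hL : L ≤ 2 * M + 1) :
    ∑ k ∈ range (s * (2 * M + 1) + L), deformedCoeff z k * W k = 0 := by
  have hlast := sum_block_eq_zero hz hx hM hW s hML hL
  simp only [add_comm _ (s * _)] at hlast
  rw [sum_range_add, hlast, add_zero]
  clear hlast
  induction s with
  | zero => simp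
  | succ s ih =>
    have hblock := sum_block_eq_zero hz hx hM hW s (L := 2 * M + 1) (by omega) le_rfl
    simp only [add_comm _ (s * _)] at hblock
    rw [add_mul, one_mul, sum_range_add, hblock, add_zero, ih]

end Blocks

theorem sum_deformedCoeff_mul_eq_zero {K : Type*} [Field K] {x z : K} {N d : ℕ} (hN : Odd N)
    (hd : d = 1 ∨ d = 2) (hz : z ^ N = 1) (hz₁ : z ≠ 1) (hx : IsGeneric x z) {W : ℕ → K}
    (hW : ∀ k, W (k + 1) * ratioDen x z k = W k * ratioNum x z k) :
    ∑ k ∈ range ((N - 1) / d + 1), deformedCoeff z k * W k = 0 := by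
  obtain ⟨c, hc⟩ := orderOf_dvd_of_pow_eq_one hz
  obtain ⟨⟨M, hM⟩, ⟨s, rfl⟩⟩ : Odd (orderOf z) ∧ Odd c := Nat.odd_mul.mp (hc ▸ hN)
  have hroot : IsPrimitiveRoot z (2 * M + 1) := hM ▸ IsPrimitiveRoot.orderOf z
  have hM₀ : M ≠ 0 := by
    rintro rfl
    exact hz₁ (orderOf_eq_one_iff.mp hM)
  have hN' : N = 2 * (s * (2 * M + 1)) + (2 * M + 1) := by rw [hc, hM]; ring
  rcases hd with rfl | rfl
  · rw [show (N - 1) / 1 + 1 = 2 * s * (2 * M + 1) + (2 * M + 1) by rw [mul_assoc]; omega]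
    exact sum_blocks_eq_zero hroot hx hM₀ hW _ (by omega) le_rfl
  · rw [show (N - 1) / 2 + 1 = s * (2 * M + 1) + (M + 1) by omega]
    exact sum_blocks_eq_zero hroot hx hM₀ hW _ (by omega) (by omega)

section Specialization

variable {R K L : Type*} [CommRing R] [Field K] [Algebra R K] [Field L]

/-- The subring of `K × L` consisting of all pairs `(u / v, φ u / φ v)` with `φ v ≠ 0`. When `K` is
the fraction field of `R`, it is the graph of the extension of `φ : R →+* L` to the localization of
`R` at `ker φ`. -/
def specializationSubring (K : Type*) [Field K] [Algebra R K] (φ : R →+* L) : Subring (K × L) where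
  carrier := {p | ∃ u v, φ v ≠ 0 ∧ p.1 * algebraMap R K v = algebraMap R K u ∧ p.2 * φ v = φ u}
  zero_mem' := ⟨0, 1, by simp⟩
  one_mem' := ⟨1, 1, by simp⟩
  add_mem' := by
    rintro ⟨x, y⟩ ⟨x', y'⟩ ⟨u, v, hv, hx, hy⟩ ⟨u', v', hv', hx', hy'⟩
    refine ⟨u * v' + u' * v, v * v', by simp [hv, hv'], ?_, ?_⟩
    · simp only [map_add, map_mul, ← hx, ← hx', Prod.mk_add_mk]
      ring
    · simp only [map_add, map_mul, ← hy, ← hy', Prod.mk_add_mk]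
      ring
  mul_mem' := by
    rintro ⟨x, y⟩ ⟨x', y'⟩ ⟨u, v, hv, hx, hy⟩ ⟨u', v', hv', hx', hy'⟩
    refine ⟨u * u', v * v', by simp [hv, hv'], ?_, ?_⟩
    · simp only [map_mul, ← hx, ← hx', Prod.mk_mul_mk]
      ring
    · simp only [map_mul, ← hy, ← hy', Prod.mk_mul_mk]
      ring
  neg_mem' := by
    rintro ⟨x, y⟩ ⟨u, v, hv, hx, hy⟩
    exact ⟨-u, v, hv, by simp [← hx], by simp [← hy]⟩

/-- The element `x` of `K` takes the value `y` under the extension of the ring homomorphism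
`φ : R →+* L` to fractions `u / v` with `φ v ≠ 0`. -/
def SpecializesTo (φ : R →+* L) (x : K) (y : L) : Prop :=
  (x, y) ∈ specializationSubring K φ

variable {φ : R →+* L} {x x' : K} {y y' : L}

theorem specializesTo_algebraMap (φ : R →+* L) (u : R) :
    SpecializesTo φ (algebraMap R K u) (φ u) :=
  ⟨u, 1, by simp⟩

namespace SpecializesTo

theorem neg (h : SpecializesTo φ x y) : SpecializesTo φ (-x) (-y) :=
  Subring.neg_mem _ h

theorem mul (h : SpecializesTo φ x y) (h' : SpecializesTo φ x' y') :
    SpecializesTo φ (x * x') (y * y') :=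
  Subring.mul_mem _ h h'

theorem sub (h : SpecializesTo φ x y) (h' : SpecializesTo φ x' y') :
    SpecializesTo φ (x - x') (y - y') :=
  Subring.sub_mem _ h h'

theorem pow (h : SpecializesTo φ x y) (m : ℕ) : SpecializesTo φ (x ^ m) (y ^ m) :=
  Subring.pow_mem _ h m

theorem one : SpecializesTo φ (1 : K) 1 :=
  Subring.one_mem _

theorem sum {ι : Type*} {s : Finset ι} {f : ι → K} {g : ι → L}
    (h : ∀ i ∈ s, SpecializesTo φ (f i) (g i)) :
    SpecializesTo φ (∑ i ∈ s, f i) (∑ i ∈ s, g i) := by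
  rw [SpecializesTo, prod_mk_sum]
  exact Subring.sum_mem _ h

theorem prod {ι : Type*} {s : Finset ι} {f : ι → K} {g : ι → L}
    (h : ∀ i ∈ s, SpecializesTo φ (f i) (g i)) :
    SpecializesTo φ (∏ i ∈ s, f i) (∏ i ∈ s, g i) := by
  rw [SpecializesTo, prod_mk_prod]
  exact Subring.prod_mem _ h

theorem qInteger (h : SpecializesTo φ x y) (m : ℕ) :
    SpecializesTo φ (qInteger x m) (qInteger y m) :=
  sum fun i _ => h.pow i

theorem deformedCoeff (h : SpecializesTo φ x y) (k : ℕ) :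
    SpecializesTo φ (deformedCoeff x k) (deformedCoeff y k) :=
  (h.pow _).mul (h.qInteger _)

theorem ratioNum (h : SpecializesTo φ x y) (h' : SpecializesTo φ x' y') (i : ℕ) :
    SpecializesTo φ (ratioNum x x' i) (ratioNum y y' i) :=
  ((one.sub (h.mul (h'.pow _))).mul (h.sub (h'.pow _))).mul (one.sub (h'.pow _))

theorem ratioDen (h : SpecializesTo φ x y) (h' : SpecializesTo φ x' y') (i : ℕ) :
    SpecializesTo φ (ratioDen x x' i) (ratioDen y y' i) :=
  ((one.sub (h.mul (h'.pow _))).mul (h.sub (h'.pow _))).mul (one.sub (h'.pow _))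

variable [IsFractionRing R K]

theorem unique (h : SpecializesTo φ x y) (h' : SpecializesTo φ x y') : y = y' := by
  obtain ⟨u, v, hv, hu, hφ⟩ := h.sub h'
  rw [sub_self, zero_mul, eq_comm, IsFractionRing.to_map_eq_zero_iff] at hu
  rw [hu, map_zero] at hφ
  exact sub_eq_zero.mp ((mul_eq_zero.mp hφ).resolve_right hv)

theorem ne_zero (h : SpecializesTo φ x y) (hy : y ≠ 0) : x ≠ 0 := by
  rintro rfl
  exact hy (h.unique (Subring.zero_mem _))

theorem inv (h : SpecializesTo φ x y) (hy : y ≠ 0) : SpecializesTo φ x⁻¹ y⁻¹ := by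
  have hx := h.ne_zero hy
  obtain ⟨u, v, hv, hu, hφ⟩ := h
  dsimp only at hu hφ
  refine ⟨v, u, hφ ▸ mul_ne_zero hy hv, ?_, ?_⟩
  · rw [← hu, inv_mul_cancel_left₀ hx]
  · rw [← hφ, inv_mul_cancel_left₀ hy]

theorem div (h : SpecializesTo φ x y) (h' : SpecializesTo φ x' y') (hy' : y' ≠ 0) :
    SpecializesTo φ (x / x') (y / y') := by
  simpa only [div_eq_mul_inv] using h.mul (h'.inv hy')

theorem deformedSum {a q : K} {b z : L} (ha : SpecializesTo φ a b) (hq : SpecializesTo φ q z)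
    (hb : b ≠ 0) {M : ℕ} (hden : ∀ i < M, _root_.ratioDen b z i ≠ 0) :
    SpecializesTo φ (deformedSum a q M) (deformedSum b z M) := by
  rw [deformedSum_eq_sum_weight (ha.ne_zero hb), deformedSum_eq_sum_weight hb]
  refine sum fun k hk => (hq.deformedCoeff k).mul (prod fun i hi => ?_)
  have hiM : i < M := (mem_range.mp hi).trans_le (mem_range_succ_iff.mp hk)
  exact (ha.ratioNum hq i).div (ha.ratioDen hq i) (hden i hiM)

theorem deformedSum_pow_odd {a q : K} {z : L} {j M : ℕ}
    (hz : Function.Injective (z ^ · : ℕ → L)) (ha : SpecializesTo φ a (z ^ (2 * j + 1)))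
    (hq : SpecializesTo φ q z) (hj : j ≤ M) :
    SpecializesTo φ (_root_.deformedSum a q M) (_root_.qInteger z (2 * j + 1) / (-z) ^ j) := by
  have hz₀ : z ≠ 0 := ne_zero_of_injective hz
  rw [← neg_pow_mul_deformedSum_pow_odd hz M j hj,
    mul_div_cancel_left₀ _ (pow_ne_zero _ (neg_ne_zero.mpr hz₀))]
  exact ha.deformedSum hq (pow_ne_zero _ hz₀) fun i _ => ratioDen_pow_odd_ne_zero hz j i

end SpecializesTo

end Specialization

section CentralQuotient

variable {R : Type*} [CommRing R]

theorem qShifted_mul_dvd (q : R) (k l : ℕ) :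
    qShifted q q k * qShifted q q l ∣ qShifted q q (k + l) := by
  induction hs : k + l generalizing k l with
  | zero =>
    obtain ⟨rfl, rfl⟩ : k = 0 ∧ l = 0 := by omega
    simp [qShifted]
  | succ s ih =>
    rcases k with _ | k
    · simp [qShifted, ← hs]
    rcases l with _ | l
    · simp [qShifted, ← hs]
    have hsplit : 1 - q * q ^ s = (1 - q * q ^ k) + q ^ (k + 1) * (1 - q * q ^ l) := by
      rw [show s = k + 1 + l by omega]
      ring
    rw [qShifted_succ q q s, hsplit, mul_add]
    refine dvd_add ?_ ?_
    · rw [qShifted_succ q q k, mul_right_comm]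
      exact mul_dvd_mul_right (ih k (l + 1) (by omega)) _
    · rw [qShifted_succ q q l, ← mul_assoc, mul_left_comm]
      exact (mul_dvd_mul_right (ih (k + 1) l (by omega)) _).mul_left _

theorem qShifted_sq_two_mul (q : R) (k : ℕ) :
    qShifted (q ^ 2) (q ^ 2) (2 * k) =
      qShifted (q ^ 2) (q ^ 4) k * qShifted (q ^ 4) (q ^ 4) k := by
  induction k with
  | zero => simp [qShifted]
  | succ k ih =>
    rw [mul_add_one, qShifted_succ, qShifted_succ, ih, qShifted_succ, qShifted_succ]
    ring

theorem qShifted_pow_four (q : R) (k : ℕ) :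
    qShifted (q ^ 4) (q ^ 4) k = qShifted (q ^ 2) (q ^ 2) k * qShifted (-q ^ 2) (q ^ 2) k := by
  rw [qShifted, qShifted, qShifted, ← prod_mul_distrib]
  exact prod_congr rfl fun i _ => by ring

theorem qShifted_pow_four_dvd [IsDomain R] {q : R} (hq : ∀ m ≠ 0, q ^ m ≠ 1) (k : ℕ) :
    qShifted (q ^ 4) (q ^ 4) k ∣ qShifted (q ^ 2) (q ^ 4) k * qShifted (-q ^ 2) (q ^ 2) k ^ 2 := by
  have hne : qShifted (q ^ 4) (q ^ 4) k ≠ 0 := qShifted_ne_zero fun i _ => by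
    rw [← pow_mul, ← pow_add]
    exact hq _ (by omega)
  have hsq := mul_dvd_mul_right (qShifted_mul_dvd (q ^ 2) k k) (qShifted (-q ^ 2) (q ^ 2) k ^ 2)
  rw [← two_mul, qShifted_sq_two_mul, ← pow_two, ← mul_pow, ← qShifted_pow_four, pow_two,
    mul_right_comm] at hsq
  exact (mul_dvd_mul_iff_right hne).mp hsq

end CentralQuotient

theorem pow_ne_neg_one_of_odd {R : Type*} [CommRing R] {z : R} {N : ℕ} (hN : Odd N)
    (hz : z ^ N = 1) (h2 : (2 : R) ≠ 0) (m : ℕ) : z ^ m ≠ -1 := fun h => h2 <| by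
  have hpow := congrArg (· ^ N) h
  simp only [hN.neg_pow, one_pow, ← pow_mul, mul_comm m] at hpow
  rw [pow_mul, hz, one_pow] at hpow
  linear_combination hpow

section RootOfUnitySpecialization

variable {R L : Type*} [CommRing R] [IsDomain R] [Field L] {φ : R →+* L} {a q : R}
  (hq : ∀ m ≠ 0, q ^ m ≠ 1)

include hq

theorem ratioDen_ne_zero_of_isGeneric_map (hx : IsGeneric (φ a) (φ q)) (i : ℕ) :
    ratioDen a q i ≠ 0 := by
  refine ratioDen_ne_zero (fun h => hx.mul_pow_ne_one (4 * i + 4) ?_)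
    (fun h => hx.ne_pow (4 * i + 4) ?_) (hq _ (by omega))
  · rw [← map_pow, ← map_mul, h, map_one]
  · rw [← map_pow, ← h]

variable (K : Type*) [Field K] [Algebra R K] [IsFractionRing R K]

/-- At a root of unity of odd order the factors `1 - q^(4i+4)` of the denominator may vanish, but
`(q^2; q^4)_k / (q^4; q^4)_k` is the quotient of a `q^2`-binomial coefficient by
`(-q^2; q^2)_k ^ 2`. -/
theorem exists_specializesTo_deformedWeight (hx : IsGeneric (φ a) (φ q))
    (hneg : ∀ m : ℕ, φ q ^ m ≠ -1) (k : ℕ) :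
    ∃ y, SpecializesTo φ (deformedWeight (algebraMap R K a) (algebraMap R K q) k) y := by
  obtain ⟨c, hc⟩ := qShifted_pow_four_dvd hq k
  set num := ∏ i ∈ range k, (1 - a * q ^ (2 * i + 1)) * (a - q ^ (2 * i + 1)) with hnum
  set den := ∏ i ∈ range k, (1 - a * q ^ (4 * i + 4)) * (a - q ^ (4 * i + 4)) with hden
  have hnum_mul : ∏ i ∈ range k, ratioNum a q i = num * qShifted (q ^ 2) (q ^ 4) k := by
    rw [hnum, qShifted, ← prod_mul_distrib]
    exact prod_congr rfl fun i _ => by rw [ratioNum]; ring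
  have hden_mul : ∏ i ∈ range k, ratioDen a q i = den * qShifted (q ^ 4) (q ^ 4) k := by
    rw [hden, qShifted, ← prod_mul_distrib]
    exact prod_congr rfl fun i _ => by rw [ratioDen]; ring
  have hden_ne : φ den ≠ 0 := by
    simp only [hden, map_prod, map_mul, map_sub, map_one, map_pow]
    exact prod_ne_zero_iff.mpr fun i _ => mul_ne_zero
      (sub_ne_zero.mpr (hx.mul_pow_ne_one _).symm) (sub_ne_zero.mpr (hx.ne_pow _))
  have hneg_ne : φ (qShifted (-q ^ 2) (q ^ 2) k ^ 2) ≠ 0 := by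
    rw [map_pow, map_qShifted]
    refine pow_ne_zero 2 (qShifted_ne_zero fun i _ h => hneg (2 + 2 * i) ?_)
    simp only [map_neg, map_pow] at h
    linear_combination -h
  have hprod : algebraMap R K (∏ i ∈ range k, ratioDen a q i) ≠ 0 :=
    (map_ne_zero_iff _ (IsFractionRing.injective R K)).mpr
      (prod_ne_zero_iff.mpr fun i _ => ratioDen_ne_zero_of_isGeneric_map hq hx i)
  refine ⟨_, num * c, den * qShifted (-q ^ 2) (q ^ 2) k ^ 2, ?_, ?_,
    div_mul_cancel₀ _ (map_mul φ _ _ ▸ mul_ne_zero hden_ne hneg_ne)⟩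
  · rw [map_mul]
    exact mul_ne_zero hden_ne hneg_ne
  · dsimp only
    simp only [deformedWeight, ← map_ratioNum, ← map_ratioDen]
    rw [prod_div_distrib, ← map_prod, ← map_prod, div_mul_eq_mul_div, div_eq_iff hprod, ← map_mul,
      ← map_mul, hnum_mul, hden_mul]
    congr 1
    linear_combination num * den * hc

theorem exists_specializesTo_deformedSum (hx : IsGeneric (φ a) (φ q))
    (hneg : ∀ m : ℕ, φ q ^ m ≠ -1) :
    ∃ W : ℕ → L, (∀ k, W (k + 1) * ratioDen (φ a) (φ q) k = W k * ratioNum (φ a) (φ q) k) ∧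
      ∀ M, SpecializesTo φ (deformedSum (algebraMap R K a) (algebraMap R K q) M)
        (∑ k ∈ range (M + 1), deformedCoeff (φ q) k * W k) := by
  choose W hW using exists_specializesTo_deformedWeight hq K hx hneg
  have ha := specializesTo_algebraMap (K := K) φ a
  have hqz := specializesTo_algebraMap (K := K) φ q
  refine ⟨W, fun k => ?_, fun M => ?_⟩
  · have hden : ratioDen (algebraMap R K a) (algebraMap R K q) k ≠ 0 := by
      rw [← map_ratioDen, map_ne_zero_iff _ (IsFractionRing.injective R K)]
      exact ratioDen_ne_zero_of_isGeneric_map hq hx k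
    have hleft := (hW (k + 1)).mul (ha.ratioDen hqz k)
    rw [deformedWeight_succ, mul_assoc, div_mul_cancel₀ _ hden] at hleft
    exact hleft.unique ((hW k).mul (ha.ratioNum hqz k))
  · rw [deformedSum_eq_sum_weight (ha.ne_zero hx.ne_zero)]
    exact SpecializesTo.sum fun k _ => (hqz.deformedCoeff k).mul (hW k)

end RootOfUnitySpecialization

section DilatedSum

theorem qInteger_mul {R : Type*} [CommRing R] (q : R) (m n : ℕ) :
    qInteger q (m * n) = qInteger q m * qInteger (q ^ m) n := by
  induction n with
  | zero => simp [qInteger]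
  | succ n ih =>
    have hadd : qInteger q (m * n + m) = qInteger q (m * n) + q ^ (m * n) * qInteger q m := by
      simp [qInteger, sum_range_add, mul_sum, pow_add]
    have hsucc : qInteger (q ^ m) (n + 1) = qInteger (q ^ m) n + (q ^ m) ^ n := by
      simp [qInteger, sum_range_succ]
    rw [mul_add_one, hadd, hsucc, ih, ← pow_mul]
    ring

theorem neg_zpow_one_sub_ediv_two {K : Type*} [Field K] (q : K) (h : ℕ) :
    (-q) ^ ((1 - ((2 * h + 1 : ℕ) : ℤ)) / 2) = ((-q) ^ h)⁻¹ := by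
  rw [show (1 - ((2 * h + 1 : ℕ) : ℤ)) / 2 = -(h : ℤ) by push_cast; omega, zpow_neg, zpow_natCast]

/-- The right-hand side of the congruence for `n = 2 h + 1`, as a function of the number of
summands. -/
def dilatedSum {K : Type*} [Field K] (a q : K) (h M : ℕ) : K :=
  ((-q) ^ h)⁻¹ * qInteger q (2 * h + 1) * deformedSum a (q ^ (2 * h + 1)) M

variable {R K L : Type*} [CommRing R] [Field K] [Algebra R K] [IsFractionRing R K] [Field L]
  {φ : R →+* L} {h : ℕ}

theorem dilatedSum_inv (a q : K) (M : ℕ) : dilatedSum a⁻¹ q h M = dilatedSum a q h M := by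
  rw [dilatedSum, deformedSum_inv, dilatedSum]

theorem SpecializesTo.dilatedSum_pow_odd {a q : K} {z : L} {j M : ℕ}
    (hz : Function.Injective (z ^ · : ℕ → L))
    (ha : SpecializesTo φ a (z ^ ((2 * j + 1) * (2 * h + 1)))) (hq : SpecializesTo φ q z)
    (hj : j ≤ M) :
    SpecializesTo φ (dilatedSum a q h M)
      (_root_.qInteger z ((2 * j + 1) * (2 * h + 1)) / (-z) ^ (j * (2 * h + 1) + h)) := by
  have hz₀ : -z ≠ 0 := neg_ne_zero.mpr (ne_zero_of_injective hz)
  have hz' : Function.Injective ((z ^ (2 * h + 1)) ^ · : ℕ → L) := fun k l hkl =>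
    Nat.eq_of_mul_eq_mul_left (Nat.succ_pos (2 * h)) (hz (by simpa only [← pow_mul] using hkl))
  rw [mul_comm (2 * j + 1), pow_mul] at ha
  have hsum := ha.deformedSum_pow_odd hz' (hq.pow _) hj
  rw [dilatedSum]
  convert (((hq.neg.pow h).inv (pow_ne_zero h hz₀)).mul (hq.qInteger (2 * h + 1))).mul hsum using 1
  rw [mul_comm (2 * j + 1), qInteger_mul, ← Odd.neg_pow ⟨h, rfl⟩, mul_comm j, pow_add (-z) (_ * j),
    pow_mul (-z), inv_mul_eq_div, div_mul_div_comm, mul_comm ((-z) ^ h)]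

variable [IsDomain R] {a q : R} {N d : ℕ}

theorem specializesTo_deformedSum_zero (hq : ∀ m ≠ 0, q ^ m ≠ 1) (hx : IsGeneric (φ a) (φ q))
    (hN : Odd N) (hd : d = 1 ∨ d = 2) (hz : φ q ^ N = 1) (hz₁ : φ q ≠ 1) (h2 : (2 : L) ≠ 0) :
    SpecializesTo φ (deformedSum (algebraMap R K a) (algebraMap R K q) ((N - 1) / d)) 0 := by
  obtain ⟨W, hW, hsum⟩ :=
    exists_specializesTo_deformedSum hq K hx (pow_ne_neg_one_of_odd hN hz h2)
  simpa only [sum_deformedCoeff_mul_eq_zero hN hd hz hz₁ hx hW] using hsum ((N - 1) / d)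

theorem specializesTo_dilatedSum_zero (hq : ∀ m ≠ 0, q ^ m ≠ 1) (hx : IsGeneric (φ a) (φ q))
    (hN : Odd N) (hd : d = 1 ∨ d = 2) (hz : φ q ^ ((2 * h + 1) * N) = 1) (hz₁ : φ q ≠ 1)
    (h2 : (2 : L) ≠ 0) :
    SpecializesTo φ (dilatedSum (algebraMap R K a) (algebraMap R K q) h ((N - 1) / d)) 0 := by
  have hz₀ : φ q ≠ 0 := fun h => by simp [h, hN.pos.ne'] at hz
  have hqz := specializesTo_algebraMap (K := K) φ q
  have hprefactor := ((hqz.neg.pow h).inv (pow_ne_zero h (neg_ne_zero.mpr hz₀))).mul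
    (hqz.qInteger (2 * h + 1))
  have hq' : ∀ m ≠ 0, (q ^ (2 * h + 1)) ^ m ≠ 1 := fun m hm => by
    rw [← pow_mul]
    exact hq _ (by positivity)
  have hx' : IsGeneric (φ a) (φ (q ^ (2 * h + 1))) := by simpa only [map_pow] using hx.pow _
  have hz' : φ (q ^ (2 * h + 1)) ^ N = 1 := by rw [map_pow, ← pow_mul, hz]
  rw [dilatedSum, ← map_pow]
  by_cases hz₁' : φ (q ^ (2 * h + 1)) = 1
  · obtain ⟨W, -, hsum⟩ :=
      exists_specializesTo_deformedSum hq' K hx' (pow_ne_neg_one_of_odd hN hz' h2)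
    have hqInt : qInteger (φ q) (2 * h + 1) = 0 := by
      apply mul_right_cancel₀ (sub_ne_zero.mpr hz₁.symm)
      rw [qInteger_mul_one_sub, ← map_pow, hz₁', sub_self, zero_mul]
    simpa only [hqInt, mul_zero, zero_mul] using hprefactor.mul (hsum ((N - 1) / d))
  · simpa only [mul_zero] using
      hprefactor.mul (specializesTo_deformedSum_zero hq' hx' hN hd hz' hz₁' h2)

end DilatedSum

section RatCongr

theorem ratCongr_iff {P : PolyQA} {A B : RatQA} :
    RatCongr P A B ↔ P ∣ IsFractionRing.num PolyQA (A - B) ∧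
      IsRelPrime (IsFractionRing.den PolyQA (A - B) : PolyQA) P := by
  have hinj := IsFractionRing.injective PolyQA RatQA
  have hden : (IsFractionRing.den PolyQA (A - B) : PolyQA) ≠ 0 := nonZeroDivisors.coe_ne_zero _
  have hfrac := IsFractionRing.mk'_num_den' (A := PolyQA) (A - B)
  have hred := IsFractionRing.num_den_reduced PolyQA (A - B)
  refine ⟨?_, fun ⟨hnum, hrel⟩ => ⟨_, _, hden, hnum, hrel, hfrac.symm⟩⟩
  rintro ⟨u, v, hv, hPu, hrel, huv⟩
  have hcross : IsFractionRing.num PolyQA (A - B) * v =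
      u * (IsFractionRing.den PolyQA (A - B) : PolyQA) := by
    apply hinj
    rw [map_mul, map_mul, ← div_eq_div_iff ((map_ne_zero_iff _ hinj).mpr hden)
      ((map_ne_zero_iff _ hinj).mpr hv), hfrac, huv]
  have hdvd : (IsFractionRing.den PolyQA (A - B) : PolyQA) ∣ v :=
    hred.symm.dvd_of_dvd_mul_left ⟨u, by rw [hcross, mul_comm]⟩
  exact ⟨hrel.symm.dvd_of_dvd_mul_right (hcross ▸ hPu.mul_right _), hrel.of_dvd_left hdvd⟩

theorem RatCongr.mul {P Q : PolyQA} {A B : RatQA} (hP : RatCongr P A B) (hQ : RatCongr Q A B)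
    (h : IsRelPrime P Q) : RatCongr (P * Q) A B := by
  rw [ratCongr_iff] at *
  exact ⟨h.mul_dvd hP.1 hQ.1, hP.2.mul_right hQ.2⟩

theorem RatCongr.prod {ι : Type*} {s : Finset ι} {P : ι → PolyQA} {A B : RatQA}
    (hP : ∀ i ∈ s, RatCongr (P i) A B)
    (h : (s : Set ι).Pairwise fun i j => IsRelPrime (P i) (P j)) :
    RatCongr (∏ i ∈ s, P i) A B := by
  simp only [ratCongr_iff] at *
  exact ⟨prod_dvd_of_isRelPrime h fun i hi => (hP i hi).1,
    IsRelPrime.prod_right fun i hi => (hP i hi).2⟩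

theorem SpecializesTo.ratCongr {L : Type*} [Field L] {φ : PolyQA →+* L} {π : PolyQA}
    (hπ : Prime π) (hφ : RingHom.ker φ = Ideal.span {π}) {A B : RatQA} {y : L}
    (hA : SpecializesTo φ A y) (hB : SpecializesTo φ B y) : RatCongr π A B := by
  have hker (u : PolyQA) : φ u = 0 ↔ π ∣ u := by
    rw [← RingHom.mem_ker, hφ, Ideal.mem_span_singleton]
  obtain ⟨u, v, hv, hu, hφu⟩ := hA.sub hB
  have hv₀ : v ≠ 0 := fun h => hv (by rw [h, map_zero])
  refine ⟨u, v, hv₀, (hker u).mp ?_, ?_, ?_⟩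
  · rw [← hφu, sub_self, zero_mul]
  · exact (hπ.irreducible.isRelPrime_iff_not_dvd.mpr fun h => hv ((hker v).mpr h)).symm
  · rwa [eq_div_iff ((map_ne_zero_iff _ (IsFractionRing.injective PolyQA RatQA)).mpr hv₀)]

theorem exists_ker_eq_span_singleton.{u} {R : Type u} [CommRing R] {π : R} (hπ : Prime π) :
    ∃ (L : Type u) (_ : Field L) (φ : R →+* L), RingHom.ker φ = Ideal.span {π} := by
  have := (Ideal.span_singleton_prime hπ.ne_zero).mpr hπ
  exact ⟨(Ideal.span {π}).ResidueField, inferInstance, algebraMap _ _,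
    Ideal.ker_algebraMap_residueField _⟩

variable {R S : Type*} [CommRing R] [CommRing S] {π : R}

theorem isRelPrime_of_map [IsDomain R] (hπ : Prime π) (f : R →+* S) (hf : f π = 0) {v : R}
    (hv : f v ≠ 0) : IsRelPrime π v :=
  hπ.irreducible.isRelPrime_iff_not_dvd.mpr fun h => hv (zero_dvd_iff.mp (hf ▸ map_dvd f h))

variable {L : Type*} [Field L] {φ : R →+* L}

theorem map_eq_map_of_ker_eq_span (hφ : RingHom.ker φ = Ideal.span {π}) (f : R →+* S)
    (hf : f π = 0) {u v : R} (huv : φ u = φ v) : f u = f v := by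
  rw [← sub_eq_zero, ← map_sub, ← RingHom.mem_ker, hφ, Ideal.mem_span_singleton] at huv
  exact sub_eq_zero.mp (by simpa [hf] using map_dvd f huv)

theorem IsGeneric.of_ker_eq_span (hφ : RingHom.ker φ = Ideal.span {π}) (f : R →+* S)
    (hf : f π = 0) {a q : R} (h : IsGeneric (f a) (f q)) : IsGeneric (φ a) (φ q) where
  ne_zero ha := h.ne_zero <| by
    simpa using map_eq_map_of_ker_eq_span hφ f hf (ha.trans (map_zero φ).symm)
  ne_pow i hi := h.ne_pow i <| by
    simpa using map_eq_map_of_ker_eq_span hφ f hf (hi.trans (map_pow φ q i).symm)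
  mul_pow_ne_one i hi := h.mul_pow_ne_one i <| by
    simpa using map_eq_map_of_ker_eq_span hφ f hf (u := a * q ^ i) (v := 1) (by simpa using hi)

end RatCongr

section Moduli

/-- The ring homomorphism `ℤ[q, a] → S` with `q ↦ z` and `a ↦ x`. -/
noncomputable def evalQA {S : Type*} [CommRing S] (z x : S) : PolyQA →+* S :=
  eval₂RingHom (eval₂RingHom (Int.castRingHom S) z) x

/-- The polynomial `(1 - a q^N) (a - q^N)`, whose zero locus consists of the curves `a = q^(-N)` and
`a = q^N`. -/
noncomputable def curveFactor (N : ℕ) : PolyQA :=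
  (1 - polyA * polyQ ^ N) * (polyA - polyQ ^ N)

variable {S : Type*} [CommRing S] (z x : S)

theorem evalQA_polyQ : evalQA z x polyQ = z := by simp [evalQA, polyQ]

theorem evalQA_polyA : evalQA z x polyA = x := by simp [evalQA, polyA]

theorem evalQA_C (p : ℤ[X]) : evalQA z x (C p) = p.eval₂ (Int.castRingHom S) z := by
  simp [evalQA]

theorem evalQA_curveFactor (N : ℕ) :
    evalQA z x (curveFactor N) = (1 - x * z ^ N) * (x - z ^ N) := by
  simp [curveFactor, evalQA_polyQ, evalQA_polyA]

theorem evalQA_two_zpow_curveFactor_eq_zero_iff {N : ℕ} {e : ℤ} :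
    evalQA (2 : ℚ) (2 ^ e) (curveFactor N) = 0 ↔ e = -N ∨ e = N := by
  have hinj := zpow_right_injective₀ (a := (2 : ℚ)) two_pos (by norm_num)
  rw [evalQA_curveFactor, mul_eq_zero, sub_eq_zero, sub_eq_zero, ← zpow_natCast,
    ← zpow_add₀ two_ne_zero, ← zpow_zero (2 : ℚ), hinj.eq_iff, hinj.eq_iff]
  omega

theorem polyQ_pow_ne_one {m : ℕ} (hm : m ≠ 0) : polyQ ^ m ≠ 1 := fun h => by
  simpa [evalQA_polyQ, hm] using congrArg (evalQA (0 : ℤ) 0) h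

theorem prime_polyA_sub_polyQ_pow (N : ℕ) : Prime (polyA - polyQ ^ N) := by
  rw [polyA, polyQ, ← C_pow]
  exact prime_X_sub_C _

theorem prime_one_sub_polyA_mul_polyQ_pow (N : ℕ) : Prime (1 - polyA * polyQ ^ N) := by
  have h : 1 - polyA * polyQ ^ N = C (-X ^ N) * X + C 1 := by
    simp only [polyA, polyQ, map_neg, map_pow, C_1]
    ring
  rw [h]
  exact (irreducible_C_mul_X_add_C (neg_ne_zero.mpr (pow_ne_zero _ X_ne_zero))
    isRelPrime_one_right).prime

theorem prime_C_cyclotomic {m : ℕ} (hm : 0 < m) : Prime (C (cyclotomic m ℤ) : PolyQA) :=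
  prime_C_iff.mpr (cyclotomic.irreducible hm).prime

theorem qInteger_polyQ {N : ℕ} (hN : 0 < N) :
    qInteger polyQ N = ∏ m ∈ N.divisors.erase 1, C (cyclotomic m ℤ) := by
  rw [← map_prod, prod_cyclotomic_eq_geom_sum hN]
  simp [qInteger, polyQ]

theorem evalQA_C_cyclotomic_eq_zero_iff {ζ : ℂ} {m m' : ℕ} (hζ : IsPrimitiveRoot ζ m)
    (hm' : 0 < m') : evalQA (C ζ) (X : ℂ[X]) (C (cyclotomic m' ℤ)) = 0 ↔ m' = m := by
  have : NeZero (m' : ℂ) := ⟨Nat.cast_ne_zero.mpr hm'.ne'⟩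
  have heval : evalQA (C ζ) (X : ℂ[X]) (C (cyclotomic m' ℤ)) =
      C ((cyclotomic m' ℂ).eval ζ) := by
    rw [evalQA_C, ← map_cyclotomic_int m' ℂ, eval_map, hom_eval₂]
    congr 1
  rw [heval, C_eq_zero, ← IsRoot.def, isRoot_cyclotomic_iff]
  exact ⟨fun h => h.unique hζ, fun h => h ▸ hζ⟩

theorem isGeneric_X_C {R : Type*} [CommRing R] [Nontrivial R] (r : R) :
    IsGeneric (X : R[X]) (C r) where
  ne_zero := X_ne_zero
  ne_pow i := by
    rw [← C_pow]
    exact X_ne_C _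
  mul_pow_ne_one i h := by simpa using congrArg (eval 0) h

theorem isRelPrime_C_cyclotomic {m m' : ℕ} (hm : 0 < m) (hm' : 0 < m') (hne : m ≠ m') :
    IsRelPrime (C (cyclotomic m ℤ) : PolyQA) (C (cyclotomic m' ℤ)) := by
  have hζ := Complex.isPrimitiveRoot_exp m hm.ne'
  exact isRelPrime_of_map (prime_C_cyclotomic hm) _
    ((evalQA_C_cyclotomic_eq_zero_iff hζ hm).mpr rfl)
    ((evalQA_C_cyclotomic_eq_zero_iff hζ hm').not.mpr hne.symm)

theorem isRelPrime_C_cyclotomic_curveFactor {m : ℕ} (hm : 0 < m) (N : ℕ) :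
    IsRelPrime (C (cyclotomic m ℤ)) (curveFactor N) := by
  have hζ := Complex.isPrimitiveRoot_exp m hm.ne'
  have hgen := isGeneric_X_C (Complex.exp (2 * Real.pi * Complex.I / m))
  refine isRelPrime_of_map (prime_C_cyclotomic hm) _
    ((evalQA_C_cyclotomic_eq_zero_iff hζ hm).mpr rfl) ?_
  rw [evalQA_curveFactor]
  exact mul_ne_zero (sub_ne_zero.mpr (hgen.mul_pow_ne_one N).symm)
    (sub_ne_zero.mpr (hgen.ne_pow N))

theorem evalQA_two_zpow_neg_one_sub (N : ℕ) :
    evalQA (2 : ℚ) (2 ^ (-N : ℤ)) (1 - polyA * polyQ ^ N) = 0 := by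
  simp [evalQA_polyQ, evalQA_polyA]

theorem evalQA_two_zpow_sub (N : ℕ) :
    evalQA (2 : ℚ) (2 ^ (N : ℤ)) (polyA - polyQ ^ N) = 0 := by
  simp [evalQA_polyQ, evalQA_polyA]

theorem isRelPrime_curveFactor {N N' : ℕ} (hne : N ≠ N') :
    IsRelPrime (curveFactor N) (curveFactor N') :=
  IsRelPrime.mul_left
    (isRelPrime_of_map (prime_one_sub_polyA_mul_polyQ_pow N) _ (evalQA_two_zpow_neg_one_sub N)
      (evalQA_two_zpow_curveFactor_eq_zero_iff.not.mpr (by omega)))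
    (isRelPrime_of_map (prime_polyA_sub_polyQ_pow N) _ (evalQA_two_zpow_sub N)
      (evalQA_two_zpow_curveFactor_eq_zero_iff.not.mpr (by omega)))

theorem isRelPrime_one_sub_sub {N : ℕ} (hN : N ≠ 0) :
    IsRelPrime (1 - polyA * polyQ ^ N) (polyA - polyQ ^ N) := by
  have hinj := zpow_right_injective₀ (a := (2 : ℚ)) two_pos (by norm_num)
  refine isRelPrime_of_map (prime_one_sub_polyA_mul_polyQ_pow N) _
    (evalQA_two_zpow_neg_one_sub N) ?_
  rw [map_sub, map_pow, evalQA_polyA, evalQA_polyQ, ← zpow_natCast, sub_ne_zero, hinj.ne_iff]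
  omega

end Moduli

section Congruences

theorem injective_two_pow : Function.Injective ((2 : ℚ) ^ · : ℕ → ℚ) :=
  pow_right_injective₀ two_pos (by norm_num)

variable {h j M M' N m d : ℕ} {π : PolyQA}

theorem ratCongr_of_dvd_curveFactor (hπ : Prime π)
    (hdvd : π ∣ curveFactor ((2 * j + 1) * (2 * h + 1))) {x : ℚ} (hx : evalQA 2 x π = 0)
    (hM : j * (2 * h + 1) + h ≤ M) (hM' : j ≤ M') :
    RatCongr π (deformedSum ratA ratQ M) (dilatedSum ratA ratQ h M') := by
  obtain ⟨L, _, φ, hφ⟩ := exists_ker_eq_span_singleton hπ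
  have hz : Function.Injective (φ polyQ ^ · : ℕ → L) := fun k l hkl =>
    injective_two_pow <| by
      simpa [evalQA_polyQ] using map_eq_map_of_ker_eq_span hφ _ hx
        (u := polyQ ^ k) (v := polyQ ^ l) (by simpa using hkl)
  have ha := specializesTo_algebraMap (K := RatQA) φ polyA
  have hq := specializesTo_algebraMap (K := RatQA) φ polyQ
  have hodd : (2 * j + 1) * (2 * h + 1) = 2 * (j * (2 * h + 1) + h) + 1 := by ring
  have hcongr {a : RatQA} (ha : SpecializesTo φ a (φ polyQ ^ ((2 * j + 1) * (2 * h + 1)))) :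
      RatCongr π (deformedSum a ratQ M) (dilatedSum a ratQ h M') := by
    have hright := ha.dilatedSum_pow_odd hz hq hM'
    rw [hodd] at ha hright
    exact (ha.deformedSum_pow_odd hz hq hM).ratCongr hπ hφ hright
  have hmem : φ (curveFactor ((2 * j + 1) * (2 * h + 1))) = 0 := by
    rwa [← RingHom.mem_ker, hφ, Ideal.mem_span_singleton]
  rw [curveFactor, map_mul, mul_eq_zero] at hmem
  simp only [map_sub, map_mul, map_pow, map_one, sub_eq_zero] at hmem
  rcases hmem with hinv | heq
  · rw [← deformedSum_inv, ← dilatedSum_inv]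
    have ha₀ : φ polyA ≠ 0 := left_ne_zero_of_mul_eq_one hinv.symm
    exact hcongr (eq_inv_of_mul_eq_one_right hinv.symm ▸ ha.inv ha₀)
  · exact hcongr (heq ▸ ha)

theorem ratCongr_curveFactor (hM : j * (2 * h + 1) + h ≤ M) (hM' : j ≤ M') :
    RatCongr (curveFactor ((2 * j + 1) * (2 * h + 1))) (deformedSum ratA ratQ M)
      (dilatedSum ratA ratQ h M') :=
  (ratCongr_of_dvd_curveFactor (prime_one_sub_polyA_mul_polyQ_pow _) (dvd_mul_right _ _)
      (evalQA_two_zpow_neg_one_sub _) hM hM').mul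
    (ratCongr_of_dvd_curveFactor (prime_polyA_sub_polyQ_pow _) (dvd_mul_left _ _)
      (evalQA_two_zpow_sub _) hM hM')
    (isRelPrime_one_sub_sub (by positivity))

theorem mul_add_le_sub_one_div (hd : d = 1 ∨ d = 2) (hN : 0 < N) (hj : j ≤ (N - 1) / d) :
    j * (2 * h + 1) + h ≤ ((2 * h + 1) * N - 1) / d := by
  rcases hd with rfl | rfl
  · have hjN : j + 1 ≤ N := by omega
    have hmul := Nat.mul_le_mul_left (2 * h + 1) hjN
    have hexpand : (2 * h + 1) * (j + 1) = j * (2 * h + 1) + (2 * h + 1) := by ring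
    omega
  · have hjN : 2 * j + 1 ≤ N := by omega
    have hmul := Nat.mul_le_mul_left (2 * h + 1) hjN
    have hexpand : (2 * h + 1) * (2 * j + 1) = 2 * (j * (2 * h + 1)) + (2 * h + 1) := by ring
    omega

theorem ratCongr_C_cyclotomic (hm₁ : m ≠ 1) (hm : m ∣ (2 * h + 1) * N) (hN : Odd N)
    (hd : d = 1 ∨ d = 2) :
    RatCongr (C (cyclotomic m ℤ)) (deformedSum ratA ratQ (((2 * h + 1) * N - 1) / d))
      (dilatedSum ratA ratQ h ((N - 1) / d)) := by
  have hodd : Odd ((2 * h + 1) * N) := Odd.mul ⟨h, rfl⟩ hN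
  have hm₀ : 0 < m := Nat.pos_of_dvd_of_pos hm hodd.pos
  have hprime := prime_C_cyclotomic hm₀
  have hζ := Complex.isPrimitiveRoot_exp m hm₀.ne'
  have hf := (evalQA_C_cyclotomic_eq_zero_iff hζ hm₀).mpr rfl
  obtain ⟨L, _, φ, hφ⟩ := exists_ker_eq_span_singleton hprime
  have hz : φ polyQ ^ ((2 * h + 1) * N) = 1 := by
    rw [← map_pow, ← sub_eq_zero, ← map_one φ, ← map_sub, ← RingHom.mem_ker, hφ,
      Ideal.mem_span_singleton]
    obtain ⟨c, hc⟩ := hm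
    simpa [hc, polyQ] using _root_.map_dvd (C : ℤ[X] →+* PolyQA)
      ((cyclotomic.dvd_X_pow_sub_one m ℤ).trans (pow_one_sub_dvd_pow_mul_sub_one X m c))
  have hz₁ : φ polyQ ≠ 1 := fun hone => hζ.ne_one (by omega) <| C_injective <| by
    simpa [evalQA_polyQ] using map_eq_map_of_ker_eq_span hφ _ hf (hone.trans (map_one φ).symm)
  have h2 : (2 : L) ≠ 0 := fun h2 => by
    have htwo := map_eq_map_of_ker_eq_span hφ _ hf
      ((map_ofNat φ 2).trans (h2.trans (map_zero φ).symm))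
    rw [map_ofNat, map_zero] at htwo
    exact two_ne_zero htwo
  have hgen : IsGeneric (φ polyA) (φ polyQ) :=
    .of_ker_eq_span hφ _ hf (by rw [evalQA_polyA, evalQA_polyQ]; exact isGeneric_X_C _)
  exact (specializesTo_deformedSum_zero (fun _ => polyQ_pow_ne_one) hgen hodd hd hz hz₁ h2).ratCongr
    hprime hφ (specializesTo_dilatedSum_zero (fun _ => polyQ_pow_ne_one) hgen hN hd hz hz₁ h2)

end Congruences

theorem mainTheorem4_general {n m d : ℕ} (hn : Odd n) (hm : Odd m) (hd : d = 1 ∨ d = 2) :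
    RatCongr
      (qInteger polyQ (n * m) *
        ∏ j ∈ range ((m - 1) / d + 1),
          ((1 - polyA * polyQ ^ ((2 * j + 1) * n)) * (polyA - polyQ ^ ((2 * j + 1) * n))))
      (deformedSum ratA ratQ ((n * m - 1) / d))
      ((-ratQ) ^ ((1 - (n : ℤ)) / 2) * qInteger ratQ n *
        deformedSum ratA (ratQ ^ n) ((m - 1) / d)) := by
  obtain ⟨h, rfl⟩ := hn
  have hnm : 0 < (2 * h + 1) * m := Nat.mul_pos (Nat.succ_pos _) hm.pos
  rw [neg_zpow_one_sub_ediv_two, qInteger_polyQ hnm]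
  have hpos {l : ℕ} (hl : l ∈ ((2 * h + 1) * m).divisors.erase 1) : 0 < l :=
    Nat.pos_of_mem_divisors (mem_of_mem_erase hl)
  refine RatCongr.mul (.prod (fun l hl => ?_) fun l hl l' hl' hne => ?_)
    (.prod (fun j hj => ?_) fun i _ j _ hne => ?_)
    (.prod_left fun l hl => .prod_right fun j _ => ?_)
  · exact ratCongr_C_cyclotomic (ne_of_mem_erase hl)
      (Nat.dvd_of_mem_divisors (mem_of_mem_erase hl)) hm hd
  · exact isRelPrime_C_cyclotomic (hpos hl) (hpos hl') hne
  · have hj' := mem_range_succ_iff.mp hj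
    exact ratCongr_curveFactor (mul_add_le_sub_one_div hd hm.pos hj') hj'
  · refine isRelPrime_curveFactor fun heq => hne ?_
    have := Nat.eq_of_mul_eq_mul_right (Nat.succ_pos (2 * h)) heq
    omega
  · exact isRelPrime_C_cyclotomic_curveFactor (hpos hl) _

theorem mainTheorem4 (n r d : ℕ) (hn : 1 < n) (hodd : Odd n) (hr : 1 ≤ r) (hd : d = 1 ∨ d = 2) :
    RatCongr
      (qInteger polyQ (n ^ r) *
        ∏ j ∈ Finset.range ((n ^ (r - 1) - 1) / d + 1),
          ((1 - polyA * polyQ ^ ((2 * j + 1) * n)) * (polyA - polyQ ^ ((2 * j + 1) * n))))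
      (deformedSum ratA ratQ ((n ^ r - 1) / d))
      ((-ratQ) ^ ((1 - (n : ℤ)) / 2) * qInteger ratQ n *
        deformedSum ratA (ratQ ^ n) ((n ^ (r - 1) - 1) / d)) := by
  rw [← mul_pow_sub_one (Nat.one_le_iff_ne_zero.mp hr) n]
  exact mainTheorem4_general hodd hodd.pow hd
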